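/- **Theorem (General lower bound on the Rényi resolvability exponent).** Let $\mathcal X,\mathcal Y$ be finite alphabets, $P_{Y|X}$ a channel from $\mathcal X$ to $\mathcal Y$, and $Q_Y$ a distribution on $\mathcal Y$ such that $\mathcal P(P_{Y|X},Q_Y):=\{P_X:\sum_x P_X(x)P_{Y|X}(\cdot|x)=Q_Y\}$ is non-empty. For mass functions $P,Q$ on a finite set and $s\ge -1$ let $$D_{1+s}(P\|Q):=\frac1s\log\sum_{a:P(a)>0}P(a)^{1+s}Q(a)^{-s}\quad(s\neq0),\qquad D_1(P\|Q):=D(P\|Q):=\sum_a P(a)\log\frac{P(a)}{Q(a)},$$ with values in $[0,\infty]$ for probability mass functions (so $D_0(P\|Q)=-\log Q(\{a:P(a)>0\})$). For a rate $R$ and blocklength $n$ let $M_n=\lfloor e^{nR}\rfloor$. Let $U_n$ be a random variable (common randomness) with a finite alphabet, independent of a message $m$ that is uniform on $\{1,\dots,M_n\}$, let $f_{u}:\{1,\dots,M_n\}\to\mathcal X^n$ be a map for each value $u$ of $U_n$, and let $$P_{Y^n|U_n}(y^n|u)=\frac1{M_n}\sum_{m=1}^{M_n}\prod_{i=1}^nP_{Y|X}(y_i|f_{u,i}(m)).$$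 The optimal Rényi resolvability is $\inf_{f_{U_n}}D_{1+s}(P_{Y^nU_n}\|Q_Y^n\times P_{U_n})$, the infimum being over all $U_n$ and all $f$. Define $$R_{1+s}(P_{Y|X},Q_Y):=\begin{cases}\min_{P_X\in\mathcal P(P_{Y|X},Q_Y)}\sum_xP_X(x)D_{1+s}(P_{Y|X}(\cdot|x)\|Q_Y)&s\in(0,1],\\ \min_{P_X\in\mathcal P(P_{Y|X},Q_Y)}\sum_xP_X(x)D(P_{Y|X}(\cdot|x)\|Q_Y)&s\in(-1,0],\\0&s=-1.\end{cases}$$ Let $s\in[-1,1]$ and $R>R_{1+s}(P_{Y|X},Q_Y)$. Then $$\liminf_{n\to\infty}-\frac1n\log\inf_{f_{U_n}}D_{1+s}(P_{Y^nU_n}\|Q_Y^n\times P_{U_n})\;\ge\;\sup_{P_X\in\mathcal P(P_{Y|X},Q_Y)}\max\{\widetilde{\mathsf E}_{\mathsf{iid}}(P_X),\mathsf E_{\mathsf{ts}}(P_X)\}$$ (with $-\log 0=\infty$), where, writing $P_{XY}=P_XP_{Y|X}$, $P_{\min}:=\min_{x:P_X(x)>0}P_X(x)$ and $[a]^+=\max\{a,0\}$,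 $$\widetilde{\mathsf E}_{\mathsf{iid}}(P_X):=\begin{cases}\left[\max_{t\in[s,1]}t\left(R-D_{1+t}(P_{XY}\|P_X\times Q_Y)\right)\right]^+&s\in(0,1],\\ \max_{t\in[0,1]}t\left(R-D_{1+t}(P_{XY}\|P_X\times Q_Y)\right)&s\in[-1,0],\end{cases}$$ $$\mathsf E_{\mathsf{ts}}(P_X):=\begin{cases}\sup_{\epsilon\in(0,1]}\min\left\{\frac{\epsilon^2P_{\min}}3,\theta(s,\epsilon,P_X)\right\}&s\in(0,1],\\ \sup_{\epsilon\in(0,1]}\min\left\{\frac{\epsilon^2P_{\min}}3,\theta(0,\epsilon,P_X)\right\}&s\in[-1,0],\end{cases}$$ $$\theta(s,\epsilon,P_X):=\max_{t\in[s,1]}t\Big(R-(1+\epsilon)\sum_xP_X(x)D_{1+t}(P_{Y|X}(\cdot|x)\|Q_Y)\Big).$$ Moreover, if $s\in(-1,1]$, the left-hand side is strictly positive, i.e. the optimal Rényi resolvability decays at least exponentially fast. -/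

import Mathlib

open Filter
open scoped ENNReal

noncomputable section

namespace RenyiResolvability

/-- The Rényi divergence `D_{1+s}(p‖q)` (natural logarithm) of two mass functions on a finite
alphabet, with values in `[-∞, ∞]`.  For `s ≠ 0` it is
`(1/s) log ∑_{a : p a > 0} p(a)^{1+s} q(a)^{-s}`, and for `s = 0` it is the relative entropy
`∑_a p(a) log (p(a)/q(a))`.  The arithmetic of `ℝ≥0∞` and `EReal` gives the usual conventions
`0 log (0/q) = 0` and `p log (p/0) = ∞`, `p^{1+s} 0^{-s} = ∞` for `p, s > 0`.  Restricting the
sum to `p a > 0` matters for `s = -1` only, where it gives `D_0(p‖q) = - log q(p > 0)`. -/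
def renyiDiv {α : Type*} [Fintype α] (s : ℝ) (p q : α → ℝ≥0∞) : EReal :=
  if s = 0 then ∑ a, (p a : EReal) * ENNReal.log (p a / q a)
  else ((1 / s : ℝ) : EReal) *
    ENNReal.log (∑ a, if p a = 0 then 0 else p a ^ (1 + s) * q a ^ (-s))

/-- The mass function of the product distribution `Q^n`. -/
def iidMass {Y : Type*} (Q : PMF Y) (n : ℕ) : (Fin n → Y) → ℝ≥0∞ :=
  fun y => ∏ i, Q (y i)

/-- The mass function on `𝒴ⁿ` of the output of `n` uses of the channel `W = P_{Y|X}` when the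
input is the codeword of a message that is uniform on `M` messages, for the code
`c : Fin M → 𝒳ⁿ`. -/
def outputMass {X Y : Type*} (W : X → PMF Y) {n M : ℕ} (c : Fin M → Fin n → X) :
    (Fin n → Y) → ℝ≥0∞ :=
  fun y => (M : ℝ≥0∞)⁻¹ * ∑ m, ∏ i, W (c m i) (y i)

/-- `D_{1+s}(P_{Yⁿ U} ‖ Q_Yⁿ × P_U)` for common randomness `U ~ PU` on a finite alphabet,
independent of the message, and the random map `f_U` from messages to `𝒳ⁿ`. -/
def codeDiv {X Y : Type*} [Fintype Y] (W : X → PMF Y) (Q : PMF Y) (s : ℝ) {n M k : ℕ}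
    (PU : PMF (Fin k)) (f : Fin k → Fin M → Fin n → X) : EReal :=
  renyiDiv s
    (fun z : (Fin n → Y) × Fin k => PU z.2 * outputMass W (f z.2) z.1)
    (fun z : (Fin n → Y) × Fin k => iidMass Q n z.1 * PU z.2)

/-- The number of messages at rate `R` and blocklength `n` (equal to `e^{nR}` when that is an
integer). -/
def numMessages (R : ℝ) (n : ℕ) : ℕ := ⌊Real.exp (n * R)⌋₊

/-- The optimal Rényi resolvability `inf_{f_U} D_{1+s}(P_{Yⁿ U} ‖ Q_Yⁿ × P_U)` at blocklength `n`
and rate `R`: the infimum over all finite common randomness and all random maps. -/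
def optResolvability {X Y : Type*} [Fintype Y] (W : X → PMF Y) (Q : PMF Y) (s R : ℝ)
    (n : ℕ) : EReal :=
  ⨅ (k : ℕ) (PU : PMF (Fin k)) (f : Fin k → Fin (numMessages R n) → Fin n → X),
    codeDiv W Q s PU f

/-- The exponent `liminf_n -(1/n) log inf_{f_U} D_{1+s}(P_{Yⁿ U} ‖ Q_Yⁿ × P_U)`, with
`- log 0 = ∞`. -/
def resolvabilityExponent {X Y : Type*} [Fintype Y] (W : X → PMF Y) (Q : PMF Y)
    (s R : ℝ) : EReal :=
  liminf (fun n : ℕ => ((-(1 / (n : ℝ)) : ℝ) : EReal) *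
    ENNReal.log (optResolvability W Q s R n).toENNReal) atTop

/-- The set `𝒫(P_{Y|X}, Q_Y)` of input distributions that induce the output distribution
`Q`. -/
def inducing {X Y : Type*} (W : X → PMF Y) (Q : PMF Y) : Set (PMF X) :=
  {P | P.bind W = Q}

/-- `∑_x P_X(x) D_{1+s}(P_{Y|X}(·|x) ‖ Q_Y)`; for `s = 0` this is the conditional relative
entropy `D(P_{Y|X} ‖ Q_Y | P_X)`. -/
def avgDiv {X Y : Type*} [Fintype X] [Fintype Y] (W : X → PMF Y) (Q : PMF Y) (s : ℝ)
    (P : PMF X) : EReal :=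
  ∑ x, (P x : EReal) * renyiDiv s (W x) Q

/-- `D_{1+s}(P_{XY} ‖ P_X × Q_Y)` with `P_{XY} = P_X P_{Y|X}`. -/
def jointDiv {X Y : Type*} [Fintype X] [Fintype Y] (W : X → PMF Y) (Q : PMF Y) (s : ℝ)
    (P : PMF X) : EReal :=
  renyiDiv s (fun z : X × Y => P z.1 * W z.1 z.2) (fun z : X × Y => P z.1 * Q z.2)

/-- The rate threshold `R_{1+s}(P_{Y|X}, Q_Y)`, for `s ≥ -1`. -/
def rateThreshold {X Y : Type*} [Fintype X] [Fintype Y] (W : X → PMF Y) (Q : PMF Y)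
    (s : ℝ) : EReal :=
  if 0 < s then ⨅ P ∈ inducing W Q, avgDiv W Q s P
  else if -1 < s then ⨅ P ∈ inducing W Q, avgDiv W Q 0 P
  else 0

/-- The exponent of i.i.d. random codes with input distribution `P`. -/
def expIid {X Y : Type*} [Fintype X] [Fintype Y] (W : X → PMF Y) (Q : PMF Y) (s R : ℝ)
    (P : PMF X) : EReal :=
  if 0 < s then
    max (⨆ t ∈ Set.Icc s 1, (t : EReal) * ((R : EReal) - jointDiv W Q t P)) 0
  else ⨆ t ∈ Set.Icc (0 : ℝ) 1, (t : EReal) * ((R : EReal) - jointDiv W Q t P)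

/-- `θ(s, ε, P_X) = max_{t ∈ [s,1]} t (R - (1+ε) ∑_x P_X(x) D_{1+t}(P_{Y|X}(·|x) ‖ Q_Y))`. -/
def theta {X Y : Type*} [Fintype X] [Fintype Y] (W : X → PMF Y) (Q : PMF Y) (R : ℝ)
    (s ε : ℝ) (P : PMF X) : EReal :=
  ⨆ t ∈ Set.Icc s 1,
    (t : EReal) * ((R : EReal) - ((1 + ε : ℝ) : EReal) * avgDiv W Q t P)

/-- The smallest positive value of the mass function of `P`. -/
def pMin {X : Type*} (P : PMF X) : ℝ := (⨅ x ∈ P.support, P x).toReal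

/-- The exponent of typical-set codes with input distribution `P`. -/
def expTs {X Y : Type*} [Fintype X] [Fintype Y] (W : X → PMF Y) (Q : PMF Y) (s R : ℝ)
    (P : PMF X) : EReal :=
  if 0 < s then
    ⨆ ε ∈ Set.Ioc (0 : ℝ) 1, min ((ε ^ 2 * pMin P / 3 : ℝ) : EReal) (theta W Q R s ε P)
  else
    ⨆ ε ∈ Set.Ioc (0 : ℝ) 1, min ((ε ^ 2 * pMin P / 3 : ℝ) : EReal) (theta W Q R 0 ε P)

end RenyiResolvability

end

/-! The bound is soft covering by a random code. For `s ≤ t` with `0 < t ≤ 1`, draw the `M`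
codewords independently from a law on `𝒳ⁿ`. Pulling one factor out of the `(1 + t)`-th power of the
output mass, then using subadditivity and concavity of `x ^ t`, bounds its mean by a single-codeword
term, damped by `M ^ (-t)`, plus the same power of the mean output (`moment_sum_le`). If the mean
output is at most `A * Qⁿ`, some fixed code does as well as the average (`exists_code`), so common
randomness is not needed. Monotonicity in the order and `log (1 + B) ≤ B` turn the moment into a
bound on `D_{1+s}`, with exponent `min a (t * (R - b))` (`le_exponent_of_random`).

I.i.d. letters from `P` give `A = 1` and `b = D_{1+t}(P_XY‖P_X × Q_Y)`. Conditioning them on words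
in which no letter is overrepresented by more than `1 + ε` lowers `b` to `1 + ε` times the average
divergence; the price is `A = 1/κ`, with `κ` the probability of these words, and a Chernoff bound
puts `A - 1` at exponent `ε² P_min / 3`. A constant code gives exponent `0`, which covers `t = 0`
and the positive part. Strict positivity is the typical-word bound with small `ε` and, when `s ≤ 0`,
small `t > 0`. -/

noncomputable section

namespace RenyiResolvability

/-- The Rényi divergence of order `1 + s` in terms of real weights `w` and likelihood
ratios `r`. -/
def ratioDiv {α : Type*} [Fintype α] (w r : α → ℝ) (s : ℝ) : ℝ :=
  if s = 0 then ∑ a, w a * Real.log (r a) else 1 / s * Real.log (∑ a, w a * r a ^ s)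

/-! ### Monotonicity, sign and continuity of the divergence in its order -/

section ratioDiv

variable {α : Type*} [Fintype α] {w r : α → ℝ}

lemma sum_mul_pos (hw : ∀ a, 0 ≤ w a) (hw1 : ∑ a, w a = 1) {z : α → ℝ} (hz : ∀ a, 0 < z a) :
    0 < ∑ a, w a * z a := by
  obtain ⟨a, -, ha⟩ : ∃ a ∈ Finset.univ, w a ≠ 0 :=
    Finset.exists_ne_zero_of_sum_ne_zero (by rw [hw1]; exact one_ne_zero)
  refine Finset.sum_pos' (fun a _ => mul_nonneg (hw a) (hz a).le) ⟨a, Finset.mem_univ a, ?_⟩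
  exact mul_pos (lt_of_le_of_ne (hw a) (Ne.symm ha)) (hz a)

lemma sum_mul_log_le (hw : ∀ a, 0 ≤ w a) (hw1 : ∑ a, w a = 1) {z : α → ℝ} (hz : ∀ a, 0 < z a) :
    ∑ a, w a * Real.log (z a) ≤ Real.log (∑ a, w a * z a) := by
  simpa using strictConcaveOn_log_Ioi.concaveOn.le_map_sum (t := Finset.univ) (w := w) (p := z)
    (fun a _ => hw a) hw1 (fun a _ => hz a)

lemma sum_mul_log_rpow (hr : ∀ a, 0 < r a) (s : ℝ) :
    ∑ a, w a * Real.log (r a ^ s) = s * ∑ a, w a * Real.log (r a) := by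
  rw [Finset.mul_sum]
  refine Finset.sum_congr rfl fun a _ => ?_
  rw [Real.log_rpow (hr a)]; ring

lemma ratioDiv_zero_le (hw : ∀ a, 0 ≤ w a) (hw1 : ∑ a, w a = 1) (hr : ∀ a, 0 < r a) {t : ℝ}
    (ht : 0 ≤ t) : ratioDiv w r 0 ≤ ratioDiv w r t := by
  rcases ht.eq_or_lt with rfl | ht
  · exact le_rfl
  have h := sum_mul_log_le hw hw1 (fun a => Real.rpow_pos_of_pos (hr a) t)
  rw [sum_mul_log_rpow hr] at h
  rw [ratioDiv, ratioDiv, if_pos rfl, if_neg ht.ne', one_div, inv_mul_eq_div, le_div_iff₀ ht]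
  linarith

lemma ratioDiv_le_zero (hw : ∀ a, 0 ≤ w a) (hw1 : ∑ a, w a = 1) (hr : ∀ a, 0 < r a) {s : ℝ}
    (hs : s ≤ 0) : ratioDiv w r s ≤ ratioDiv w r 0 := by
  rcases hs.eq_or_lt with rfl | hs
  · exact le_rfl
  have h := sum_mul_log_le hw hw1 (fun a => Real.rpow_pos_of_pos (hr a) s)
  rw [sum_mul_log_rpow hr] at h
  rw [ratioDiv, ratioDiv, if_pos rfl, if_neg hs.ne, one_div, inv_mul_eq_div, div_le_iff_of_neg hs]
  linarith

/-- Jensen for `log` compares either sign with `0`; two positive parameters are compared by the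
power mean inequality with exponent `t / s`. -/
lemma ratioDiv_mono (hw : ∀ a, 0 ≤ w a) (hw1 : ∑ a, w a = 1) (hr : ∀ a, 0 < r a) {s t : ℝ}
    (hst : s ≤ t) (ht : 0 ≤ t) : ratioDiv w r s ≤ ratioDiv w r t := by
  rcases le_or_gt s 0 with hs | hs
  · exact (ratioDiv_le_zero hw hw1 hr hs).trans (ratioDiv_zero_le hw hw1 hr ht)
  have ht' : 0 < t := hs.trans_le hst
  have hpm := Real.rpow_arith_mean_le_arith_mean_rpow Finset.univ w (fun a => r a ^ s)
    (fun a _ => hw a) hw1 (fun a _ => (Real.rpow_pos_of_pos (hr a) s).le) (p := t / s)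
    ((one_le_div hs).2 hst)
  have hpos : 0 < ∑ a, w a * r a ^ s :=
    sum_mul_pos hw hw1 (fun a => Real.rpow_pos_of_pos (hr a) s)
  have hpow : ∀ a, (r a ^ s) ^ (t / s) = r a ^ t := fun a => by
    rw [← Real.rpow_mul (hr a).le, mul_div_cancel₀ _ hs.ne']
  simp only [hpow] at hpm
  have hlog := Real.log_le_log (Real.rpow_pos_of_pos hpos _) hpm
  rw [Real.log_rpow hpos] at hlog
  rw [ratioDiv, ratioDiv, if_neg hs.ne', if_neg ht'.ne', one_div, inv_mul_eq_div, one_div,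
    inv_mul_eq_div, le_div_iff₀ ht']
  calc _ = t / s * Real.log (∑ a, w a * r a ^ s) := by ring
    _ ≤ _ := hlog

lemma ratioDiv_nonneg (hw : ∀ a, 0 ≤ w a) (hw1 : ∑ a, w a = 1) (hr : ∀ a, 0 < r a)
    (hsub : ∑ a, w a * (r a)⁻¹ ≤ 1) {t : ℝ} (ht : 0 ≤ t) : 0 ≤ ratioDiv w r t := by
  -- At parameter `-1` the divergence is `-log ∑ w / r`, which `hsub` makes nonnegative.
  refine le_trans ?_ (ratioDiv_mono hw hw1 hr (s := -1) (by linarith) ht)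
  have hpos := sum_mul_pos hw hw1 (fun a => inv_pos.2 (hr a))
  rw [ratioDiv, if_neg (by norm_num)]
  simp only [Real.rpow_neg_one]
  have := Real.log_nonpos hpos.le hsub
  linarith

lemma ratioDiv_one_le (hw : ∀ a, 0 ≤ w a) (hw1 : ∑ a, w a = 1) (hr : ∀ a, 0 < r a) {C : ℝ}
    (hC : ∀ a, r a ≤ C) : ratioDiv w r 1 ≤ Real.log C := by
  have hpos := sum_mul_pos hw hw1 hr
  simp only [ratioDiv, one_ne_zero, if_false, div_one, one_mul, Real.rpow_one]
  refine Real.log_le_log hpos ?_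
  calc ∑ a, w a * r a ≤ ∑ a, w a * C :=
        Finset.sum_le_sum fun a _ => mul_le_mul_of_nonneg_left (hC a) (hw a)
    _ = C := by rw [← Finset.sum_mul, hw1, one_mul]

/-- The value at `t ≠ 0` is the slope between `0` and `t` of `log ∑ w r ^ s`, whose derivative at
`0` is the relative entropy. -/
lemma ratioDiv_tendsto (hw1 : ∑ a, w a = 1) (hr : ∀ a, 0 < r a) :
    Tendsto (ratioDiv w r) (nhdsWithin 0 (Set.Ioi 0)) (nhds (ratioDiv w r 0)) := by
  have hd : HasDerivAt (fun s : ℝ => ∑ a, w a * r a ^ s) (∑ a, w a * Real.log (r a)) 0 := by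
    refine HasDerivAt.fun_sum fun a _ => ?_
    have := ((Real.hasStrictDerivAt_const_rpow (hr a) 0).hasDerivAt).const_mul (w a)
    simpa using this
  have hl := hd.log (by simp [hw1])
  have hsl := (hasDerivAt_iff_tendsto_slope.1 hl).mono_left
    (nhdsWithin_mono 0 (fun x (hx : 0 < x) => hx.ne') :
      nhdsWithin (0 : ℝ) (Set.Ioi 0) ≤ nhdsWithin 0 {0}ᶜ)
  have h0 : ratioDiv w r 0 = (∑ a, w a * Real.log (r a)) / ∑ a, w a * r a ^ (0 : ℝ) := by
    simp [ratioDiv, hw1]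
  rw [h0]
  refine hsl.congr' ?_
  filter_upwards [self_mem_nhdsWithin] with t ht
  simp [ratioDiv, (Set.mem_Ioi.1 ht).ne', slope, hw1]

end ratioDiv

/-- The likelihood ratio of `p` with respect to `q`, set to `1` outside the support of `p`. -/
def likRatio {α : Type*} (p q : α → ℝ≥0∞) (a : α) : ℝ :=
  if p a = 0 then 1 else (p a / q a).toReal

/-! ### From extended mass functions to real likelihood ratios -/

section likRatio

variable {α : Type*} {p q : α → ℝ≥0∞}

/-- The default value `1` keeps ratios positive off the support, where their weight is zero anyway.
-/
lemma likRatio_pos (hp : ∀ a, p a ≠ ⊤) (hq : ∀ a, q a ≠ ⊤) (hac : ∀ a, q a = 0 → p a = 0)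
    (a : α) : 0 < likRatio p q a := by
  unfold likRatio
  split_ifs with h
  · exact one_pos
  · exact ENNReal.toReal_pos (ENNReal.div_ne_zero.2 ⟨h, hq a⟩)
      (ENNReal.div_ne_top (hp a) fun h' => h (hac a h'))

lemma coe_finset_sum {ι : Type*} (t : Finset ι) (f : ι → ℝ) :
    ((∑ i ∈ t, f i : ℝ) : EReal) = ∑ i ∈ t, (f i : EReal) := by
  classical
  induction t using Finset.induction_on with
  | empty => simp
  | insert a t ha ih => rw [Finset.sum_insert ha, Finset.sum_insert ha, EReal.coe_add, ih]

lemma mul_rpow_likRatio (hp : ∀ a, p a ≠ ⊤) (hq : ∀ a, q a ≠ ⊤) (hac : ∀ a, q a = 0 → p a = 0)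
    (s : ℝ) (a : α) :
    (if p a = 0 then 0 else p a ^ (1 + s) * q a ^ (-s)) =
      ENNReal.ofReal ((p a).toReal * likRatio p q a ^ s) := by
  unfold likRatio
  split_ifs with h
  · simp [h]
  · have hq0 : q a ≠ 0 := fun h' => h (hac a h')
    have hd0 : p a / q a ≠ 0 := ENNReal.div_ne_zero.2 ⟨h, hq a⟩
    have hdt : p a / q a ≠ ⊤ := ENNReal.div_ne_top (hp a) hq0
    rw [ENNReal.ofReal_mul ENNReal.toReal_nonneg, ENNReal.ofReal_toReal (hp a),
      ← ENNReal.ofReal_rpow_of_pos (ENNReal.toReal_pos hd0 hdt), ENNReal.ofReal_toReal hdt,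
      ENNReal.rpow_add _ _ h (hp a), ENNReal.rpow_one, div_eq_mul_inv,
      ENNReal.mul_rpow_of_ne_top (hp a) (ENNReal.inv_ne_top.2 hq0), ENNReal.inv_rpow,
      ENNReal.rpow_neg, mul_assoc]

variable [Fintype α]

lemma ne_top_of_sum_eq_one (hp1 : ∑ a, p a = 1) (a : α) : p a ≠ ⊤ :=
  (ENNReal.sum_ne_top.1 (by rw [hp1]; exact ENNReal.one_ne_top)) a (Finset.mem_univ a)

lemma sum_toReal_eq_one (hp1 : ∑ a, p a = 1) : ∑ a, (p a).toReal = 1 := by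
  rw [← ENNReal.toReal_sum fun a _ => ne_top_of_sum_eq_one hp1 a, hp1, ENNReal.toReal_one]

lemma sum_mul_inv_likRatio_le (hp1 : ∑ a, p a = 1) (hq1 : ∑ a, q a = 1) : ∑ a, (p a).toReal * (likRatio p q a)⁻¹ ≤ 1 := by
  rw [← sum_toReal_eq_one hq1]
  refine Finset.sum_le_sum fun a _ => ?_
  unfold likRatio
  split_ifs with h
  · simp [h]
  · rw [ENNReal.toReal_div, inv_div, mul_div_cancel₀]
    exact ENNReal.toReal_ne_zero.2 ⟨h, ne_top_of_sum_eq_one hp1 a⟩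

lemma renyiDiv_eq_ratioDiv (hp1 : ∑ a, p a = 1) (hq : ∀ a, q a ≠ ⊤)
    (hac : ∀ a, q a = 0 → p a = 0) (s : ℝ) :
    renyiDiv s p q = (ratioDiv (fun a => (p a).toReal) (likRatio p q) s : ℝ) := by
  have hp := ne_top_of_sum_eq_one hp1
  have hr := likRatio_pos hp hq hac
  unfold renyiDiv ratioDiv
  split_ifs with hs
  · rw [coe_finset_sum]
    refine Finset.sum_congr rfl fun a _ => ?_
    by_cases h : p a = 0
    · simp [h]
    · have hq0 : q a ≠ 0 := fun h' => h (hac a h')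
      rw [ENNReal.log_pos_real (ENNReal.div_ne_zero.2 ⟨h, hq a⟩)
        (ENNReal.div_ne_top (hp a) hq0), likRatio, if_neg h, EReal.coe_mul,
        EReal.coe_ennreal_toReal (hp a)]
  · simp_rw [mul_rpow_likRatio hp hq hac s]
    rw [← ENNReal.ofReal_sum_of_nonneg fun a _ =>
        mul_nonneg ENNReal.toReal_nonneg (Real.rpow_pos_of_pos (hr a) s).le,
      ENNReal.log_ofReal_of_pos, EReal.coe_mul]
    exact sum_mul_pos (fun a => ENNReal.toReal_nonneg) (sum_toReal_eq_one hp1)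
      (fun a => Real.rpow_pos_of_pos (hr a) s)

lemma renyiDiv_mono (hp1 : ∑ a, p a = 1) (hq : ∀ a, q a ≠ ⊤) (hac : ∀ a, q a = 0 → p a = 0)
    {s t : ℝ} (hst : s ≤ t) (ht : 0 ≤ t) : renyiDiv s p q ≤ renyiDiv t p q := by
  rw [renyiDiv_eq_ratioDiv hp1 hq hac, renyiDiv_eq_ratioDiv hp1 hq hac, EReal.coe_le_coe_iff]
  exact ratioDiv_mono (fun a => ENNReal.toReal_nonneg) (sum_toReal_eq_one hp1)
    (likRatio_pos (ne_top_of_sum_eq_one hp1) hq hac) hst ht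

lemma sum_rpow_mul_rpow_eq_exp (hp1 : ∑ a, p a = 1) (hq : ∀ a, q a ≠ ⊤)
    (hac : ∀ a, q a = 0 → p a = 0) {t : ℝ} (ht : 0 < t) :
    ∑ a, p a ^ (1 + t) * q a ^ (-t) = ENNReal.ofReal
      (Real.exp (t * ratioDiv (fun a => (p a).toReal) (likRatio p q) t)) := by
  have hp := ne_top_of_sum_eq_one hp1
  have hr := likRatio_pos hp hq hac
  have hpos := sum_mul_pos (fun a => ENNReal.toReal_nonneg) (sum_toReal_eq_one hp1)
      (fun a => Real.rpow_pos_of_pos (hr a) t)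
  rw [ratioDiv, if_neg ht.ne', ← mul_assoc, mul_one_div_cancel ht.ne', one_mul,
    Real.exp_log hpos, ENNReal.ofReal_sum_of_nonneg fun a _ =>
        mul_nonneg ENNReal.toReal_nonneg (Real.rpow_pos_of_pos (hr a) t).le]
  refine Finset.sum_congr rfl fun a _ => ?_
  rw [← mul_rpow_likRatio hp hq hac]
  split_ifs with h
  · rw [h, ENNReal.zero_rpow_of_pos (by linarith), zero_mul]
  · rfl

/-- Absolute continuity need not be assumed: a point with `q = 0 < p` would make the moment
infinite. -/
lemma renyiDiv_le_log_of_sum_le (hp1 : ∑ a, p a = 1) (hq : ∀ a, q a ≠ ⊤) {s t B : ℝ}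
    (hst : s ≤ t) (ht : 0 < t)
    (hB : ∑ a, p a ^ (1 + t) * q a ^ (-t) ≤ ENNReal.ofReal (1 + B)) (hB0 : 0 ≤ B) :
    renyiDiv s p q ≤ (B / t : ℝ) := by
  have hac : ∀ a, q a = 0 → p a = 0 := by
    intro a ha
    by_contra h
    have hfin := ENNReal.sum_ne_top.1 (ne_top_of_le_ne_top ENNReal.ofReal_ne_top hB) a
      (Finset.mem_univ a)
    refine hfin ?_
    rw [ha, ENNReal.zero_rpow_of_neg (by linarith), ENNReal.mul_top]
    exact (ENNReal.rpow_pos (pos_iff_ne_zero.2 h) (ne_top_of_sum_eq_one hp1 a)).ne'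
  refine (renyiDiv_mono hp1 hq hac hst ht.le).trans ?_
  rw [sum_rpow_mul_rpow_eq_exp hp1 hq hac ht, ENNReal.ofReal_le_ofReal_iff (by linarith)] at hB
  rw [renyiDiv_eq_ratioDiv hp1 hq hac, EReal.coe_le_coe_iff, le_div_iff₀ ht]
  have := Real.add_one_le_exp (t * ratioDiv (fun a => (p a).toReal) (likRatio p q) t)
  have h2 := Real.add_one_le_exp B
  have := Real.exp_le_exp.1 (hB.trans (by linarith : 1 + B ≤ Real.exp B))
  linarith

end likRatio

lemma rpow_one_add (x : ℝ≥0∞) {t : ℝ} (ht : 0 ≤ t) : x ^ (1 + t) = x * x ^ t := by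
  rw [ENNReal.rpow_add_of_nonneg 1 t zero_le_one ht, ENNReal.rpow_one]

/-! ### Moments of random codes and soft covering -/

section RandomCode

variable {Z : Type*} [Fintype Z] {ν : Z → ℝ≥0∞}

/-- Jensen for the concave power `t`, read off from the convex power `1 / t`. -/
lemma sum_mul_rpow_le (hν : ∑ z, ν z = 1) (a : Z → ℝ≥0∞) {t : ℝ} (ht : 0 ≤ t) (ht1 : t ≤ 1) :
    ∑ z, ν z * a z ^ t ≤ (∑ z, ν z * a z) ^ t := by
  rcases ht.eq_or_lt with rfl | ht
  · simp [hν]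
  have h := ENNReal.rpow_arith_mean_le_arith_mean_rpow Finset.univ ν (fun z => a z ^ t) hν
    (p := 1 / t) ((one_le_div ht).2 ht1)
  simp only [← ENNReal.rpow_mul, mul_one_div_cancel ht.ne', ENNReal.rpow_one] at h
  calc _ = ((∑ z, ν z * a z ^ t) ^ (1 / t)) ^ t := by
        rw [← ENNReal.rpow_mul, one_div_mul_cancel ht.ne', ENNReal.rpow_one]
    _ ≤ _ := ENNReal.rpow_le_rpow h ht.le

lemma sum_prod_eq_one (hν : ∑ z, ν z = 1) (N : ℕ) : ∑ c : Fin N → Z, ∏ j, ν (c j) = 1 := by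
  rw [← Fintype.sum_pow, hν, one_pow]

lemma sum_insertNth {N : ℕ} (m : Fin (N + 1)) (F : (Fin (N + 1) → Z) → ℝ≥0∞) :
    ∑ c : Fin (N + 1) → Z, (∏ j, ν (c j)) * F c =
      ∑ z, ν z * ∑ c : Fin N → Z, (∏ j, ν (c j)) * F (m.insertNth z c) := by
  rw [← (Fin.insertNthEquiv (fun _ => Z) m).sum_comp, Fintype.sum_prod_type]
  refine Finset.sum_congr rfl fun z _ => ?_
  rw [Finset.mul_sum]
  refine Finset.sum_congr rfl fun c _ => ?_
  rw [Fin.prod_univ_succAbove _ m]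
  simp [Fin.insertNthEquiv, mul_assoc]

lemma sum_prod_mul_sum (hν : ∑ z, ν z = 1) (a : Z → ℝ≥0∞) (N : ℕ) :
    ∑ c : Fin N → Z, (∏ j, ν (c j)) * ∑ j, a (c j) = N * ∑ z, ν z * a z := by
  cases N with
  | zero => simp
  | succ N =>
    simp_rw [Finset.mul_sum]
    rw [Finset.sum_comm]
    have : ∀ m : Fin (N + 1), ∑ c : Fin (N + 1) → Z, (∏ j, ν (c j)) * a (c m) =
        ∑ z, ν z * a z := fun m => by
      rw [sum_insertNth m]
      refine Finset.sum_congr rfl fun z _ => ?_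
      simp [← Finset.sum_mul, sum_prod_eq_one hν]
    simp_rw [this]
    simp [Finset.mul_sum]

/-- The `(1 + t)`-th moment of a sum of i.i.d. nonnegative terms. -/
lemma moment_sum_le (hν : ∑ z, ν z = 1) (a : Z → ℝ≥0∞) {t : ℝ} (ht : 0 ≤ t) (ht1 : t ≤ 1)
    (M : ℕ) :
    ∑ c : Fin M → Z, (∏ j, ν (c j)) * (∑ j, a (c j)) ^ (1 + t) ≤
      M * ∑ z, ν z * a z ^ (1 + t) + (M * ∑ z, ν z * a z) ^ (1 + t) := by
  cases M with
  | zero => simp [ENNReal.zero_rpow_of_pos (show 0 < 1 + t by linarith)]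
  | succ N =>
    set b := ∑ z, ν z * a z with hb
    -- One factor of the power is expanded over `m`. Then `(x + y) ^ t ≤ x ^ t + y ^ t` separates
    -- codeword `m` from the other `N`, which are independent of it and are averaged by Jensen.
    have hterm : ∀ m : Fin (N + 1),
        ∑ c : Fin (N + 1) → Z, (∏ j, ν (c j)) * (a (c m) * (∑ j, a (c j)) ^ t) ≤
          ∑ z, ν z * a z ^ (1 + t) + b * ((N + 1 : ℕ) * b) ^ t := fun m => by
      rw [sum_insertNth m]
      have hin : ∀ z, ∑ c : Fin N → Z, (∏ j, ν (c j)) *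
          (a ((m.insertNth z c : Fin (N + 1) → Z) m) *
            (∑ j, a ((m.insertNth z c : Fin (N + 1) → Z) j)) ^ t) ≤
          a z ^ (1 + t) + a z * ((N + 1 : ℕ) * b) ^ t := fun z => by
        calc _ ≤ ∑ c : Fin N → Z, ((∏ j, ν (c j)) * (a z * a z ^ t) +
              a z * ((∏ j, ν (c j)) * (∑ j, a (c j)) ^ t)) := by
              refine Finset.sum_le_sum fun c _ => ?_
              rw [Fin.sum_univ_succAbove _ m]
              simp only [Fin.insertNth_apply_same, Fin.insertNth_apply_succAbove]
              calc _ ≤ (∏ j, ν (c j)) * (a z * (a z ^ t + (∑ j, a (c j)) ^ t)) := by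
                    gcongr
                    exact ENNReal.rpow_add_le_add_rpow _ _ ht ht1
                _ = _ := by ring
          _ = a z ^ (1 + t) + a z * ∑ c : Fin N → Z, (∏ j, ν (c j)) * (∑ j, a (c j)) ^ t := by
              rw [Finset.sum_add_distrib, ← Finset.sum_mul, sum_prod_eq_one hν, one_mul,
                ← Finset.mul_sum, rpow_one_add _ ht]
          _ ≤ _ := by
              gcongr
              refine (sum_mul_rpow_le (sum_prod_eq_one hν N) _ ht ht1).trans ?_
              rw [sum_prod_mul_sum hν]
              gcongr
              exact Nat.le_succ N
      calc _ ≤ ∑ z, ν z * (a z ^ (1 + t) + a z * ((N + 1 : ℕ) * b) ^ t) := by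
            gcongr with z; exact hin z
        _ = _ := by
            simp only [mul_add, Finset.sum_add_distrib, ← mul_assoc, ← Finset.sum_mul, ← hb]
    calc _ = ∑ m : Fin (N + 1), ∑ c : Fin (N + 1) → Z,
          (∏ j, ν (c j)) * (a (c m) * (∑ j, a (c j)) ^ t) := by
          rw [Finset.sum_comm]
          refine Finset.sum_congr rfl fun c _ => ?_
          rw [rpow_one_add _ ht, Finset.sum_mul, Finset.mul_sum]
      _ ≤ ∑ m : Fin (N + 1), (∑ z, ν z * a z ^ (1 + t) + b * ((N + 1 : ℕ) * b) ^ t) :=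
          Finset.sum_le_sum fun m _ => hterm m
      _ = _ := by
          rw [rpow_one_add ((N + 1 : ℕ) * b : ℝ≥0∞) ht]
          simp only [Finset.sum_const, Finset.card_univ, Fintype.card_fin, nsmul_eq_mul]
          ring

lemma moment_average_le (hν : ∑ z, ν z = 1) (a : Z → ℝ≥0∞) {t : ℝ} (ht : 0 ≤ t) (ht1 : t ≤ 1)
    {M : ℕ} (hM : M ≠ 0) :
    ∑ c : Fin M → Z, (∏ j, ν (c j)) * ((M : ℝ≥0∞)⁻¹ * ∑ j, a (c j)) ^ (1 + t) ≤
      (M : ℝ≥0∞) ^ (-t) * ∑ z, ν z * a z ^ (1 + t) + (∑ z, ν z * a z) ^ (1 + t) := by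
  have hM0 : (M : ℝ≥0∞) ≠ 0 := by exact_mod_cast hM
  have hMt : (M : ℝ≥0∞) ≠ ⊤ := ENNReal.natCast_ne_top M
  have h1 : (0 : ℝ) ≤ 1 + t := by linarith
  simp_rw [ENNReal.mul_rpow_of_nonneg _ _ h1]
  calc _ = ((M : ℝ≥0∞)⁻¹) ^ (1 + t) *
        ∑ c : Fin M → Z, (∏ j, ν (c j)) * (∑ j, a (c j)) ^ (1 + t) := by
        rw [Finset.mul_sum]
        exact Finset.sum_congr rfl fun c _ => by ring
    _ ≤ ((M : ℝ≥0∞)⁻¹) ^ (1 + t) *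
        (M * ∑ z, ν z * a z ^ (1 + t) + (M * ∑ z, ν z * a z) ^ (1 + t)) := by
        gcongr; exact moment_sum_le hν a ht ht1 M
    _ = _ := by
        rw [mul_add, ← ENNReal.mul_rpow_of_nonneg _ _ h1, ← mul_assoc (M : ℝ≥0∞)⁻¹,
          ENNReal.inv_mul_cancel hM0 hMt, one_mul, rpow_one_add _ ht, ENNReal.inv_rpow,
          ← ENNReal.rpow_neg]
        congr 1
        calc _ = ((M : ℝ≥0∞)⁻¹ * M) * ((M : ℝ≥0∞) ^ (-t) * ∑ z, ν z * a z ^ (1 + t)) := by ring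
          _ = _ := by rw [ENNReal.inv_mul_cancel hM0 hMt, one_mul]

lemma exists_le_sum_mul [Nonempty Z] (hν : ∑ z, ν z = 1) (F : Z → ℝ≥0∞) :
    ∃ z, F z ≤ ∑ z, ν z * F z := by
  obtain ⟨z, hz⟩ := Finite.exists_min F
  refine ⟨z, ?_⟩
  calc F z = ∑ z', ν z' * F z := by rw [← Finset.sum_mul, hν, one_mul]
    _ ≤ _ := by gcongr with z'; exact hz z'

/-- Soft covering by a random code: some code with `M` codewords drawn from `ν` has a
`(1 + t)`-th moment no larger than the average over all codes. -/
theorem exists_code {α : Type*} [Fintype α] (hν : ∑ z, ν z = 1) (V : Z → α → ℝ≥0∞)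
    (hV : ∀ z, ∑ y, V z y = 1) (q : α → ℝ≥0∞) (hq : ∀ y, q y ≠ ⊤) {t : ℝ} (ht : 0 ≤ t)
    (ht1 : t ≤ 1) {M : ℕ} (hM : M ≠ 0) {A : ℝ≥0∞} (hA : ∀ y, ∑ z, ν z * V z y ≤ A * q y) :
    ∃ c : Fin M → Z, ∑ y, ((M : ℝ≥0∞)⁻¹ * ∑ m, V (c m) y) ^ (1 + t) * q y ^ (-t) ≤
      A ^ t + (M : ℝ≥0∞) ^ (-t) * ∑ z, ν z * ∑ y, V z y ^ (1 + t) * q y ^ (-t) := by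
  have : Nonempty Z := by
    by_contra h
    have := not_nonempty_iff.1 h
    simp at hν
  obtain ⟨c, hc⟩ := exists_le_sum_mul (sum_prod_eq_one hν M)
    fun c : Fin M → Z => ∑ y, ((M : ℝ≥0∞)⁻¹ * ∑ m, V (c m) y) ^ (1 + t) * q y ^ (-t)
  refine ⟨c, hc.trans ?_⟩
  -- Only `t` of the `1 + t` factors are dominated by `A * q`; the remaining one sums to `1` over
  -- `y`.
  have hmain : ∀ y, (∑ z, ν z * V z y) ^ (1 + t) * q y ^ (-t) ≤
      A ^ t * ∑ z, ν z * V z y := fun y => by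
    by_cases h0 : q y = 0
    · have : ∑ z, ν z * V z y = 0 := by simpa [h0] using hA y
      rw [this, ENNReal.zero_rpow_of_pos (by linarith)]; simp
    · calc _ = (∑ z, ν z * V z y) * (∑ z, ν z * V z y) ^ t * q y ^ (-t) := by
            rw [rpow_one_add _ ht]
        _ ≤ (∑ z, ν z * V z y) * (A * q y) ^ t * q y ^ (-t) := by gcongr; exact hA y
        _ = (∑ z, ν z * V z y) * A ^ t * (q y ^ t * q y ^ (-t)) := by
            rw [ENNReal.mul_rpow_of_nonneg _ _ ht]; ring
        _ = _ := by
            rw [← ENNReal.rpow_add _ _ h0 (hq y), add_neg_cancel, ENNReal.rpow_zero, mul_one,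
              mul_comm]
  calc _ = ∑ y, q y ^ (-t) * ∑ c : Fin M → Z, (∏ j, ν (c j)) *
          ((M : ℝ≥0∞)⁻¹ * ∑ m, V (c m) y) ^ (1 + t) := by
        simp_rw [Finset.mul_sum]
        rw [Finset.sum_comm]
        exact Finset.sum_congr rfl fun y _ => Finset.sum_congr rfl fun c _ => by ring
    _ ≤ ∑ y, q y ^ (-t) * ((M : ℝ≥0∞) ^ (-t) * ∑ z, ν z * V z y ^ (1 + t) +
          (∑ z, ν z * V z y) ^ (1 + t)) := by
        gcongr with y
        exact moment_average_le hν (fun z => V z y) ht ht1 hM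
    _ = ∑ y, (∑ z, ν z * V z y) ^ (1 + t) * q y ^ (-t) +
          (M : ℝ≥0∞) ^ (-t) * ∑ z, ν z * ∑ y, V z y ^ (1 + t) * q y ^ (-t) := by
        simp_rw [mul_add, Finset.sum_add_distrib]
        rw [add_comm]
        congr 1
        · exact Finset.sum_congr rfl fun y _ => mul_comm _ _
        · simp_rw [Finset.mul_sum]
          rw [Finset.sum_comm]
          exact Finset.sum_congr rfl fun z _ => Finset.sum_congr rfl fun y _ => by ring
    _ ≤ _ := by
        gcongr
        refine (Finset.sum_le_sum fun y _ => hmain y).trans ?_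
        rw [← Finset.mul_sum, Finset.sum_comm]
        simp_rw [← Finset.mul_sum, hV, mul_one, hν]
        exact le_of_eq (mul_one _)

end RandomCode

/-! ### Channel codes and the optimal resolvability -/

section Codes

variable {X Y : Type*} {W : X → PMF Y} {Q : PMF Y}

lemma pmf_sum_eq_one {α : Type*} [Fintype α] (p : PMF α) : ∑ a, p a = 1 := by
  rw [← p.tsum_coe, tsum_fintype]

lemma iidMass_ne_top (Q : PMF Y) {n : ℕ} (y : Fin n → Y) : iidMass Q n y ≠ ⊤ :=
  ENNReal.prod_ne_top fun i _ => Q.apply_ne_top (y i)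

variable [Fintype Y]

lemma sum_prod_channel {n : ℕ} (z : Fin n → X) : ∑ y : Fin n → Y, ∏ i, W (z i) (y i) = 1 := by
  classical
  rw [← Fintype.piFinset_univ, ← Finset.prod_univ_sum]
  simp [pmf_sum_eq_one]

lemma sum_outputMass {n M : ℕ} (hM : M ≠ 0) (c : Fin M → Fin n → X) :
    ∑ y, outputMass W c y = 1 := by
  unfold outputMass
  rw [← Finset.mul_sum, Finset.sum_comm]
  simp only [sum_prod_channel, Finset.sum_const, Finset.card_univ, Fintype.card_fin, nsmul_eq_mul,
    mul_one]
  exact ENNReal.inv_mul_cancel (by exact_mod_cast hM) (ENNReal.natCast_ne_top M)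

/-- A deterministic code is common randomness on a one-point alphabet. -/
lemma optResolvability_le (s R : ℝ) (n : ℕ) (c : Fin (numMessages R n) → Fin n → X) :
    optResolvability W Q s R n ≤ renyiDiv s (outputMass W c) (iidMass Q n) := by
  refine (iInf_le_of_le 1 <| iInf_le_of_le (PMF.pure 0) <| iInf_le_of_le (fun _ => c) ?_)
  refine le_of_eq ?_
  simp [codeDiv, renyiDiv, Fintype.sum_prod_type]

/-- A bound on the optimal resolvability through random codes drawn from `ν`. -/
theorem optResolvability_le_of_random [Fintype X] {n : ℕ} {s t R B : ℝ} {ν : (Fin n → X) → ℝ≥0∞}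
    (hν : ∑ z, ν z = 1) (hst : s ≤ t) (ht : 0 < t) (ht1 : t ≤ 1) (hM : numMessages R n ≠ 0)
    {A : ℝ≥0∞} (hA : ∀ y, ∑ z, ν z * ∏ i, W (z i) (y i) ≤ A * iidMass Q n y) (hB : 0 ≤ B)
    (hAB : A ^ t + (numMessages R n : ℝ≥0∞) ^ (-t) *
      ∑ z, ν z * ∏ i, ∑ y, W (z i) y ^ (1 + t) * Q y ^ (-t) ≤ ENNReal.ofReal (1 + B)) :
    optResolvability W Q s R n ≤ (B / t : ℝ) := by
  classical
  obtain ⟨c, hc⟩ := exists_code hν (fun z y => ∏ i, W (z i) (y i)) sum_prod_channel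
    (iidMass Q n) (iidMass_ne_top Q) ht.le ht1 hM hA
  refine (optResolvability_le s R n c).trans ?_
  refine renyiDiv_le_log_of_sum_le (sum_outputMass hM c) (iidMass_ne_top Q) hst ht
    (hc.trans (le_trans (le_of_eq ?_) hAB)) hB
  congr 2
  refine Finset.sum_congr rfl fun z _ => ?_
  rw [Finset.prod_univ_sum, Fintype.piFinset_univ]
  congr 1
  refine Finset.sum_congr rfl fun y _ => ?_
  rw [iidMass, ← ENNReal.prod_rpow_of_ne_top fun i _ => Q.apply_ne_top (y i),
    ← ENNReal.prod_rpow_of_ne_top fun i _ => (W (z i)).apply_ne_top (y i),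
    ← Finset.prod_mul_distrib]

end Codes

/-! ### From bounds at each blocklength to exponents -/

section Exponent

variable {X Y : Type*} [Fintype Y] {W : X → PMF Y} {Q : PMF Y} {s R : ℝ}

lemma le_exponent_of_eventually_le_exp {a : ℝ}
    (h : ∀ᶠ n : ℕ in atTop, optResolvability W Q s R n ≤ (Real.exp (-(n * a)) : ℝ)) :
    (a : EReal) ≤ resolvabilityExponent W Q s R := by
  refine le_liminf_of_le (by isBoundedDefault) ?_
  filter_upwards [h, eventually_gt_atTop 0] with n hn hn0
  have hn0' : (0 : ℝ) < n := by exact_mod_cast hn0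
  have h1 : ENNReal.log (optResolvability W Q s R n).toENNReal ≤ (-(n * a) : ℝ) := by
    refine (ENNReal.log_le_log (EReal.toENNReal_le_toENNReal hn)).trans ?_
    rw [EReal.real_coe_toENNReal, ENNReal.log_ofReal_of_pos (Real.exp_pos _), Real.log_exp]
  have h2 : ((1 / n : ℝ) : EReal) * ENNReal.log (optResolvability W Q s R n).toENNReal ≤
      ((1 / n : ℝ) : EReal) * (-(n * a) : ℝ) :=
    mul_le_mul_of_nonneg_left h1 (EReal.coe_nonneg.2 (by positivity))
  rw [← EReal.coe_mul] at h2
  have h3 := EReal.neg_le_neg_iff.2 h2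
  rw [EReal.coe_neg, EReal.neg_mul]
  refine le_trans (le_of_eq ?_) h3
  rw [← EReal.coe_neg, EReal.coe_eq_coe_iff]
  field_simp

/-- For every `b < a` the factor `exp (-(n * (a - b)))` eventually absorbs `n * K`. -/
lemma le_exponent_of_eventually_le {a K : ℝ} (h : ∀ᶠ n : ℕ in atTop,
      optResolvability W Q s R n ≤ (n * K * Real.exp (-(n * a)) : ℝ)) :
    (a : EReal) ≤ resolvabilityExponent W Q s R := by
  refine EReal.ge_of_forall_gt_iff_ge.1 fun b hb => ?_
  refine le_exponent_of_eventually_le_exp ?_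
  have hab : 0 < a - b := sub_pos.2 (EReal.coe_lt_coe_iff.1 hb)
  have hlim : Tendsto (fun n : ℕ => K / (a - b) *
      (((a - b) * n) ^ 1 * Real.exp (-((a - b) * n)))) atTop (nhds (K / (a - b) * 0)) :=
    ((Real.tendsto_pow_mul_exp_neg_atTop_nhds_zero 1).comp
      (tendsto_natCast_atTop_atTop.const_mul_atTop hab)).const_mul _
  rw [mul_zero] at hlim
  filter_upwards [h, hlim.eventually (gt_mem_nhds one_pos)] with n hn hlt
  refine hn.trans (EReal.coe_le_coe_iff.2 ?_)
  have e1 : Real.exp (-(n * a)) = Real.exp (-((a - b) * n)) * Real.exp (-(n * b)) := by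
    rw [← Real.exp_add]; congr 1; ring
  have e2 : K / (a - b) * (((a - b) * n) ^ 1 * Real.exp (-((a - b) * n))) =
      n * K * Real.exp (-((a - b) * n)) := by
    field_simp
  rw [e2] at hlt
  rw [e1, ← mul_assoc]
  calc _ ≤ 1 * Real.exp (-(n * b)) := by gcongr
    _ = _ := one_mul _

lemma half_exp_le_numMessages (hR : 0 < R) (n : ℕ) :
    Real.exp (n * R) / 2 ≤ numMessages R n := by
  have h1 : 1 ≤ Real.exp (n * R) := Real.one_le_exp (by positivity)
  have h2 : 1 ≤ ⌊Real.exp (n * R)⌋₊ := Nat.le_floor (by exact_mod_cast h1)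
  have h3 := Nat.lt_floor_add_one (Real.exp (n * R))
  have h4 : (1 : ℝ) ≤ ⌊Real.exp (n * R)⌋₊ := by exact_mod_cast h2
  unfold numMessages
  linarith

lemma numMessages_ne_zero (hR : 0 < R) (n : ℕ) : numMessages R n ≠ 0 := by
  have := half_exp_le_numMessages hR n
  have h2 := Real.exp_pos (n * R)
  have : (0 : ℝ) < numMessages R n := by linarith
  exact_mod_cast this.ne'

lemma numMessages_rpow_neg_le (hR : 0 < R) (n : ℕ) {t : ℝ} (ht : 0 ≤ t) (ht1 : t ≤ 1) :
    (numMessages R n : ℝ≥0∞) ^ (-t) ≤ ENNReal.ofReal (2 * Real.exp (-(n * (t * R)))) := by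
  have h0 : (0 : ℝ) < numMessages R n := by
    exact_mod_cast Nat.pos_of_ne_zero (numMessages_ne_zero hR n)
  rw [← ENNReal.ofReal_natCast, ENNReal.ofReal_rpow_of_pos h0]
  refine ENNReal.ofReal_le_ofReal ?_
  calc (numMessages R n : ℝ) ^ (-t) ≤ (Real.exp (n * R) / 2) ^ (-t) :=
        Real.rpow_le_rpow_of_nonpos (by positivity) (half_exp_le_numMessages hR n) (by linarith)
    _ = (2 : ℝ) ^ t * Real.exp (-(n * (t * R))) := by
        rw [Real.div_rpow (Real.exp_pos _).le zero_le_two, Real.rpow_neg zero_le_two, div_inv_eq_mul,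
          ← Real.exp_mul, mul_comm]
        congr 2; ring
    _ ≤ _ := by
        gcongr
        calc (2 : ℝ) ^ t ≤ 2 ^ (1 : ℝ) := Real.rpow_le_rpow_of_exponent_le one_le_two ht1
          _ = 2 := Real.rpow_one 2

/-- Exponent achieved by random codes whose output is dominated by `(1 + K e^{-na}) Qⁿ`. -/
theorem le_exponent_of_random [Fintype X] {t a b K : ℝ} (hR : 0 < R) (hst : s ≤ t) (ht : 0 < t)
    (ht1 : t ≤ 1) (hK : 0 ≤ K)
    (h : ∀ᶠ n : ℕ in atTop, ∃ (ν : (Fin n → X) → ℝ≥0∞) (A : ℝ≥0∞), ∑ z, ν z = 1 ∧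
      (∀ y, ∑ z, ν z * ∏ i, W (z i) (y i) ≤ A * iidMass Q n y) ∧
      A ^ t ≤ ENNReal.ofReal (1 + K * Real.exp (-(n * a))) ∧
      ∑ z, ν z * ∏ i, ∑ y, W (z i) y ^ (1 + t) * Q y ^ (-t) ≤
        ENNReal.ofReal (Real.exp (n * (t * b)))) :
    ((min a (t * (R - b)) : ℝ) : EReal) ≤ resolvabilityExponent W Q s R := by
  set m := min a (t * (R - b)) with hm
  -- `K` comes from the domination factor `A` and `2` from rounding down the number of messages; the
  -- extra factor `n ≥ 1` is slack.
  refine le_exponent_of_eventually_le (K := (K + 2) / t) ?_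
  filter_upwards [h, eventually_ge_atTop 1] with n hn hn1
  obtain ⟨ν, A, hν, hA, hAt, hB⟩ := hn
  have hn1' : (1 : ℝ) ≤ n := by exact_mod_cast hn1
  refine (optResolvability_le_of_random (B := (K + 2) * Real.exp (-(n * m))) hν hst ht ht1
    (numMessages_ne_zero hR n) hA (by positivity) ?_).trans (EReal.coe_le_coe_iff.2 ?_)
  · calc _ ≤ ENNReal.ofReal (1 + K * Real.exp (-(n * a))) +
          ENNReal.ofReal (2 * Real.exp (-(n * (t * R)))) *
            ENNReal.ofReal (Real.exp (n * (t * b))) := by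
          gcongr
          exact numMessages_rpow_neg_le hR n ht.le ht1
      _ = ENNReal.ofReal (1 + K * Real.exp (-(n * a)) +
            2 * Real.exp (-(n * (t * (R - b))))) := by
          rw [← ENNReal.ofReal_mul (by positivity), ← ENNReal.ofReal_add (by positivity)
            (by positivity), mul_assoc, ← Real.exp_add]
          congr 4; ring
      _ ≤ _ := by
          refine ENNReal.ofReal_le_ofReal ?_
          have h1 : Real.exp (-(n * a)) ≤ Real.exp (-(n * m)) := by
            gcongr; exact min_le_left _ _
          have h2 : Real.exp (-(n * (t * (R - b)))) ≤ Real.exp (-(n * m)) := by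
            gcongr; exact min_le_right _ _
          nlinarith
  · calc _ = 1 * ((K + 2) / t) * Real.exp (-(n * m)) := by ring
      _ ≤ _ := by gcongr

end Exponent

/-! ### Inducing input laws, i.i.d. codes and the constant code -/

section Inducing

variable {X Y : Type*} [Fintype X] {W : X → PMF Y} {Q : PMF Y} {P : PMF X}

lemma sum_mul_channel (hP : P ∈ inducing W Q) (y : Y) : ∑ x, P x * W x y = Q y := by
  have h : P.bind W = Q := hP
  rw [← h, PMF.bind_apply, tsum_fintype]

lemma mul_channel_le (hP : P ∈ inducing W Q) (x : X) (y : Y) : P x * W x y ≤ Q y := by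
  rw [← sum_mul_channel hP y]
  exact Finset.single_le_sum (f := fun x => P x * W x y) (fun _ _ => zero_le) (Finset.mem_univ x)

/-- This makes all divergences of letters used by `P` finite, hence real. -/
lemma channel_eq_zero (hP : P ∈ inducing W Q) {x : X} (hx : P x ≠ 0) (y : Y) (hy : Q y = 0) :
    W x y = 0 := by
  have := mul_channel_le hP x y
  rw [hy, nonpos_iff_eq_zero, mul_eq_zero] at this
  exact this.resolve_left hx

lemma sum_iid_mul_channel (hP : P ∈ inducing W Q) {n : ℕ} (y : Fin n → Y) :
    ∑ z : Fin n → X, (∏ i, P (z i)) * ∏ i, W (z i) (y i) = iidMass Q n y := by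
  classical
  simp_rw [← Finset.prod_mul_distrib]
  rw [← Fintype.piFinset_univ, ← Finset.prod_univ_sum (fun _ => Finset.univ)
    (fun i x => P x * W x (y i))]
  exact Finset.prod_congr rfl fun i _ => sum_mul_channel hP (y i)

variable [Fintype Y]

/-- The divergence of a single channel output distribution from `Q`, as a real number. -/
def letterDiv (W : X → PMF Y) (Q : PMF Y) (t : ℝ) (x : X) : ℝ :=
  ratioDiv (fun y => (W x y).toReal) (likRatio (W x) Q) t

lemma renyiDiv_eq_letterDiv (hP : P ∈ inducing W Q) {x : X} (hx : P x ≠ 0) (t : ℝ) :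
    renyiDiv t (W x) Q = (letterDiv W Q t x : ℝ) :=
  renyiDiv_eq_ratioDiv (pmf_sum_eq_one _) Q.apply_ne_top (channel_eq_zero hP hx) t

lemma letterDiv_nonneg (hP : P ∈ inducing W Q) {x : X} (hx : P x ≠ 0) {t : ℝ} (ht : 0 ≤ t) :
    0 ≤ letterDiv W Q t x :=
  ratioDiv_nonneg (fun _ => ENNReal.toReal_nonneg) (sum_toReal_eq_one (pmf_sum_eq_one _))
    (likRatio_pos (W x).apply_ne_top Q.apply_ne_top (channel_eq_zero hP hx))
    (sum_mul_inv_likRatio_le (pmf_sum_eq_one _) (pmf_sum_eq_one _)) ht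

lemma letterDiv_tendsto (hP : P ∈ inducing W Q) {x : X} (hx : P x ≠ 0) :
    Tendsto (fun t => letterDiv W Q t x) (nhdsWithin 0 (Set.Ioi 0)) (nhds (letterDiv W Q 0 x)) :=
  ratioDiv_tendsto (sum_toReal_eq_one (pmf_sum_eq_one _))
    (likRatio_pos (W x).apply_ne_top Q.apply_ne_top (channel_eq_zero hP hx))

/-- The average of `letterDiv` over the input distribution. -/
def avgLetterDiv (W : X → PMF Y) (Q : PMF Y) (P : PMF X) (t : ℝ) : ℝ :=
  ∑ x, (P x).toReal * letterDiv W Q t x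

lemma avgDiv_eq (hP : P ∈ inducing W Q) (t : ℝ) :
    avgDiv W Q t P = (avgLetterDiv W Q P t : ℝ) := by
  rw [avgDiv, avgLetterDiv, coe_finset_sum]
  refine Finset.sum_congr rfl fun x _ => ?_
  by_cases hx : P x = 0
  · simp [hx]
  · rw [renyiDiv_eq_letterDiv hP hx, EReal.coe_mul, EReal.coe_ennreal_toReal (P.apply_ne_top x)]

lemma avgLetterDiv_nonneg (hP : P ∈ inducing W Q) {t : ℝ} (ht : 0 ≤ t) :
    0 ≤ avgLetterDiv W Q P t := by
  refine Finset.sum_nonneg fun x _ => ?_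
  by_cases hx : P x = 0
  · simp [hx]
  · exact mul_nonneg ENNReal.toReal_nonneg (letterDiv_nonneg hP hx ht)

lemma avgLetterDiv_tendsto (hP : P ∈ inducing W Q) :
    Tendsto (avgLetterDiv W Q P) (nhdsWithin 0 (Set.Ioi 0)) (nhds (avgLetterDiv W Q P 0)) := by
  refine tendsto_finsetSum _ fun x _ => ?_
  by_cases hx : P x = 0
  · simp [hx]
  · exact (letterDiv_tendsto hP hx).const_mul _

lemma exists_jointDiv_eq (hP : P ∈ inducing W Q) {t : ℝ} (ht : 0 < t) : ∃ J : ℝ,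
    jointDiv W Q t P = (J : EReal) ∧
      ∑ x, P x * ∑ y, W x y ^ (1 + t) * Q y ^ (-t) = ENNReal.ofReal (Real.exp (t * J)) := by
  have hp1 : ∑ z : X × Y, P z.1 * W z.1 z.2 = 1 := by
    simp [Fintype.sum_prod_type, ← Finset.mul_sum, pmf_sum_eq_one]
  have hq : ∀ z : X × Y, P z.1 * Q z.2 ≠ ⊤ := fun z =>
    ENNReal.mul_ne_top (P.apply_ne_top _) (Q.apply_ne_top _)
  have hac : ∀ z : X × Y, P z.1 * Q z.2 = 0 → P z.1 * W z.1 z.2 = 0 := fun z hz => by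
    by_cases hx : P z.1 = 0
    · rw [hx, zero_mul]
    · rw [channel_eq_zero hP hx z.2 ((mul_eq_zero.1 hz).resolve_left hx), mul_zero]
  refine ⟨_, renyiDiv_eq_ratioDiv hp1 hq hac t, ?_⟩
  rw [← sum_rpow_mul_rpow_eq_exp hp1 hq hac ht, Fintype.sum_prod_type]
  refine Finset.sum_congr rfl fun x _ => ?_
  rw [Finset.mul_sum]
  refine Finset.sum_congr rfl fun y _ => ?_
  by_cases hx : P x = 0
  · simp [hx, ENNReal.zero_rpow_of_pos (show 0 < 1 + t by linarith)]
  · simp only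
    rw [ENNReal.mul_rpow_of_ne_top (P.apply_ne_top x) ((W x).apply_ne_top y),
      ENNReal.mul_rpow_of_ne_top (P.apply_ne_top x) (Q.apply_ne_top y)]
    have : P x ^ (1 + t) * P x ^ (-t) = P x := by
      rw [← ENNReal.rpow_add _ _ hx (P.apply_ne_top x), add_neg_cancel_right, ENNReal.rpow_one]
    calc _ = (P x ^ (1 + t) * P x ^ (-t)) * (W x y ^ (1 + t) * Q y ^ (-t)) := by rw [this]
      _ = _ := by ring

/-- The exponent of i.i.d. random codes. -/
theorem iid_le_exponent (hP : P ∈ inducing W Q) {s t R : ℝ} (hR : 0 < R) (hst : s ≤ t)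
    (ht : 0 < t) (ht1 : t ≤ 1) :
    (t : EReal) * ((R : EReal) - jointDiv W Q t P) ≤ resolvabilityExponent W Q s R := by
  classical
  obtain ⟨J, hJ, hsum⟩ := exists_jointDiv_eq hP ht
  rw [hJ, ← EReal.coe_sub, ← EReal.coe_mul]
  -- The mean output is exactly `Qⁿ`, so `A = 1`, `K = 0` and `a` is free; it is chosen to make the
  -- minimum trivial.
  have := le_exponent_of_random (W := W) (Q := Q) (a := t * (R - J)) (b := J) hR hst ht ht1
    le_rfl (Eventually.of_forall fun n => ⟨fun z => ∏ i, P (z i), 1,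
      sum_prod_eq_one (pmf_sum_eq_one P) n, fun y => by rw [sum_iid_mul_channel hP, one_mul],
      by simp, ?_⟩)
  · rwa [min_self] at this
  · simp_rw [← Finset.prod_mul_distrib]
    rw [← Fintype.sum_pow (fun x => P x * ∑ y, W x y ^ (1 + t) * Q y ^ (-t)), hsum,
      ← ENNReal.ofReal_pow (Real.exp_pos _).le, ← Real.exp_nat_mul]

/-- A constant code has a divergence that grows at most linearly. -/
theorem zero_le_exponent (hP : P ∈ inducing W Q) {s R : ℝ} (hR : 0 < R) (hs1 : s ≤ 1) :
    0 ≤ resolvabilityExponent W Q s R := by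
  obtain ⟨x, hx⟩ := P.support_nonempty
  have hx : P x ≠ 0 := (PMF.mem_support_iff P x).1 hx
  have hxt := P.apply_ne_top x
  -- For a letter `x` in the support, `W x ≤ Q / P x`, so the likelihood ratio of the constant word
  -- is at most `(P x)⁻¹ ^ n` and its divergence is linear in `n`.
  refine le_exponent_of_eventually_le (a := 0) (K := Real.log (P x)⁻¹.toReal) ?_
  refine Eventually.of_forall fun n => ?_
  have hM := numMessages_ne_zero hR n
  have hle : ∀ y, outputMass W (fun (_ : Fin (numMessages R n)) (_ : Fin n) => x) y ≤
      (P x)⁻¹ ^ n * iidMass Q n y := fun y => by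
    have h1 : ∏ i, W x (y i) ≤ ∏ i, ((P x)⁻¹ * Q (y i)) :=
      Finset.prod_le_prod' fun i _ => by
        rw [← ENNReal.div_eq_inv_mul, ENNReal.le_div_iff_mul_le (Or.inl hx) (Or.inl hxt), mul_comm]
        exact mul_channel_le hP x (y i)
    rw [Finset.prod_mul_distrib, Finset.prod_const, Finset.card_univ, Fintype.card_fin] at h1
    refine le_trans (le_of_eq ?_) h1
    simp only [outputMass, Finset.sum_const, Finset.card_univ, Fintype.card_fin, nsmul_eq_mul]
    rw [← mul_assoc, ENNReal.inv_mul_cancel (by exact_mod_cast hM) (ENNReal.natCast_ne_top _),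
      one_mul]
  have hac : ∀ y, iidMass Q n y = 0 →
      outputMass W (fun (_ : Fin (numMessages R n)) (_ : Fin n) => x) y = 0 := fun y hy => by
    simpa [hy] using hle y
  have hp1 := sum_outputMass (W := W) hM (fun (_ : Fin (numMessages R n)) (_ : Fin n) => x)
  have hpos := likRatio_pos (ne_top_of_sum_eq_one hp1) (iidMass_ne_top Q) hac
  have hinv : (P x)⁻¹ ≠ ⊤ := ENNReal.inv_ne_top.2 hx
  have hone : 1 ≤ (P x)⁻¹ := ENNReal.one_le_inv.2 (P.coe_le_one x)
  refine (optResolvability_le s R n _).trans ((renyiDiv_mono hp1 (iidMass_ne_top Q) hac hs1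
    zero_le_one).trans ?_)
  rw [renyiDiv_eq_ratioDiv hp1 (iidMass_ne_top Q) hac, EReal.coe_le_coe_iff]
  refine (ratioDiv_one_le (fun _ => ENNReal.toReal_nonneg) (sum_toReal_eq_one hp1) hpos
    (C := (P x)⁻¹.toReal ^ n) fun y => ?_).trans (le_of_eq (by simp [Real.log_pow]))
  rw [← ENNReal.toReal_pow]
  unfold likRatio
  split_ifs with h0
  · rw [← ENNReal.toReal_one]
    exact ENNReal.toReal_mono (ENNReal.pow_ne_top hinv) (one_le_pow₀ hone)
  · exact ENNReal.toReal_mono (ENNReal.pow_ne_top hinv)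
      (ENNReal.div_le_of_le_mul (hle y))

end Inducing

/-! ### Upper typical words and the Chernoff bound -/

section Typical

open scoped Classical in
/-- The number of occurrences of `x` in the word `z`. -/
def letterCount {X : Type*} {n : ℕ} (z : Fin n → X) (x : X) : ℕ :=
  (Finset.univ.filter fun i => z i = x).card

/-- The words in which no letter exceeds its expected frequency by a factor above `1 + ε`. -/
def IsUpperTypical {X : Type*} (p : X → ℝ) (ε : ℝ) {n : ℕ} (z : Fin n → X) : Prop :=
  ∀ x, (letterCount z x : ℝ) ≤ (1 + ε) * (n * p x)

variable {X : Type*} {n : ℕ}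

lemma letterCount_pos (z : Fin n → X) (i : Fin n) : 0 < letterCount z (z i) := by
  classical
  exact Finset.card_pos.2 ⟨i, by simp⟩

lemma prod_ite_letterCount [DecidableEq X] (z : Fin n → X) (x : X) (b : ℝ) :
    ∏ i, (if z i = x then b else 1) = b ^ letterCount z x := by
  rw [Finset.prod_ite]
  simp only [Finset.prod_const, one_pow, mul_one, letterCount]
  congr!

variable [Fintype X]

lemma sum_letter_eq (z : Fin n → X) (d : X → ℝ) :
    ∑ i, d (z i) = ∑ x, (letterCount z x : ℝ) * d x := by
  classical
  rw [← Finset.sum_fiberwise_of_maps_to (g := z) (t := Finset.univ) fun _ _ => Finset.mem_univ _]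
  refine Finset.sum_congr rfl fun x _ => ?_
  rw [Finset.sum_congr rfl fun i hi => by rw [(Finset.mem_filter.1 hi).2], Finset.sum_const,
    nsmul_eq_mul, letterCount]

/-- A one-sided frequency bound suffices because the costs are nonnegative; letters with `p x = 0`
cannot occur. -/
lemma sum_letter_le {p : X → ℝ} {ε : ℝ} {z : Fin n → X} (hz : IsUpperTypical p ε z)
    {d : X → ℝ} (hd : ∀ x, p x ≠ 0 → 0 ≤ d x) :
    ∑ i, d (z i) ≤ n * ((1 + ε) * ∑ x, p x * d x) := by
  rw [sum_letter_eq, Finset.mul_sum, Finset.mul_sum]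
  refine Finset.sum_le_sum fun x _ => ?_
  by_cases hx : p x = 0
  · have h := hz x
    rw [hx, mul_zero, mul_zero] at h
    have : (letterCount z x : ℝ) = 0 := le_antisymm h (Nat.cast_nonneg _)
    simp [this, hx]
  · calc _ ≤ (1 + ε) * (n * p x) * d x := mul_le_mul_of_nonneg_right (hz x) (hd x hx)
      _ = _ := by ring

/-- From `log (1 + ε) ≥ 2ε / (ε + 2)` the right side is at least `ε² / (ε + 2)`; the `3` is `ε + 2`
at `ε = 1`. -/
lemma chernoff_exponent {ε : ℝ} (h0 : 0 ≤ ε) (h1 : ε ≤ 1) :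
    ε ^ 2 / 3 ≤ (1 + ε) * Real.log (1 + ε) - ε := by
  have h := Real.le_log_one_add_of_nonneg h0
  have h2 : (1 + ε) * (2 * ε / (ε + 2)) ≤ (1 + ε) * Real.log (1 + ε) := by gcongr
  have h3 : (1 + ε) * (2 * ε / (ε + 2)) - ε = ε ^ 2 / (ε + 2) := by field_simp; ring
  have h4 : ε ^ 2 / 3 ≤ ε ^ 2 / (ε + 2) := by gcongr; linarith
  linarith

open scoped Classical in
/-- Multiplicative Chernoff bound for the upper tail of a letter count. -/
lemma sum_letterCount_gt_le {p : X → ℝ} (hp : ∀ x, 0 ≤ p x) (hp1 : ∑ x, p x = 1) {ε : ℝ}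
    (h0 : 0 ≤ ε) (h1 : ε ≤ 1) (x : X) :
    ∑ z : Fin n → X, (if (1 + ε) * (n * p x) < letterCount z x then ∏ i, p (z i) else 0) ≤
      Real.exp (-(n * (ε ^ 2 * p x / 3))) := by
  set L := Real.log (1 + ε) with hL
  have hpos : 0 < 1 + ε := by linarith
  have hL0 : 0 ≤ L := Real.log_nonneg (by linarith)
  -- Exponential Markov inequality with tilt `L`, for which `exp (L * count) = (1 + ε) ^ count`
  -- factors over positions.
  calc _ ≤ ∑ z : Fin n → X, Real.exp (-(L * ((1 + ε) * (n * p x)))) *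
        ∏ i, (p (z i) * if z i = x then 1 + ε else 1) := by
        refine Finset.sum_le_sum fun z _ => ?_
        have hprod : 0 ≤ ∏ i, p (z i) := Finset.prod_nonneg fun i _ => hp _
        rw [Finset.prod_mul_distrib, prod_ite_letterCount]
        split_ifs with hz
        · have h2 : 1 ≤ Real.exp (-(L * ((1 + ε) * (n * p x)))) *
              (1 + ε) ^ letterCount z x := by
            rw [← Real.exp_log hpos, ← Real.exp_nat_mul, ← Real.exp_add, Real.exp_log hpos, ← hL]
            refine Real.one_le_exp ?_
            nlinarith
          nlinarith
        · positivity
    _ = Real.exp (-(L * ((1 + ε) * (n * p x)))) * (1 + ε * p x) ^ n := by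
        rw [← Finset.mul_sum, ← Fintype.sum_pow (fun x' => p x' * if x' = x then 1 + ε else 1)]
        congr 2
        have : ∀ x', p x' * (if x' = x then 1 + ε else 1) =
            p x' + if x' = x then ε * p x' else 0 := fun x' => by
          split_ifs <;> ring
        simp [this, Finset.sum_add_distrib, hp1]
    _ ≤ Real.exp (-(L * ((1 + ε) * (n * p x)))) * Real.exp (n * (ε * p x)) := by
        rw [Real.exp_nat_mul]
        have := Real.add_one_le_exp (ε * p x)
        have h3 := mul_nonneg h0 (hp x)
        gcongr
        linarith
    _ ≤ _ := by
        rw [← Real.exp_add]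
        refine Real.exp_le_exp.2 ?_
        have h4 : 0 ≤ n * p x := mul_nonneg (Nat.cast_nonneg n) (hp x)
        have h5 := mul_le_mul_of_nonneg_left (chernoff_exponent h0 h1) h4
        rw [← hL] at h5
        linarith

open scoped Classical in
-- Union bound over letters. A null letter needs no Chernoff bound, since any word containing it has
-- probability zero; hence `m` need only bound the positive masses.
lemma one_sub_le_sum_upperTypical {p : X → ℝ} (hp : ∀ x, 0 ≤ p x) (hp1 : ∑ x, p x = 1) {ε m : ℝ}
    (h0 : 0 ≤ ε) (h1 : ε ≤ 1) (hm : ∀ x, p x ≠ 0 → m ≤ p x) :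
    1 - Fintype.card X * Real.exp (-(n * (ε ^ 2 * m / 3))) ≤
      ∑ z : Fin n → X, if IsUpperTypical p ε z then ∏ i, p (z i) else 0 := by
  have hsum : ∑ z : Fin n → X, ∏ i, p (z i) = 1 := by rw [← Fintype.sum_pow, hp1, one_pow]
  have hprod : ∀ z : Fin n → X, 0 ≤ ∏ i, p (z i) := fun z => Finset.prod_nonneg fun i _ => hp _
  have hletter : ∀ x, ∑ z : Fin n → X,
      (if (1 + ε) * (n * p x) < letterCount z x then ∏ i, p (z i) else 0) ≤
        Real.exp (-(n * (ε ^ 2 * m / 3))) := fun x => by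
    by_cases hx : p x = 0
    · refine le_trans (le_of_eq (Finset.sum_eq_zero fun z _ => ?_)) (Real.exp_pos _).le
      split_ifs with hz
      · rw [hx, mul_zero, mul_zero] at hz
        obtain ⟨i, hi⟩ := Finset.card_pos.1 (Nat.cast_pos.1 hz)
        exact Finset.prod_eq_zero (Finset.mem_univ i) (by rw [(Finset.mem_filter.1 hi).2, hx])
      · rfl
    · refine (sum_letterCount_gt_le hp hp1 h0 h1 x).trans ?_
      have := hm x hx
      gcongr
  have hunion : ∑ z : Fin n → X, ∏ i, p (z i) ≤
      ∑ z : Fin n → X, ((if IsUpperTypical p ε z then ∏ i, p (z i) else 0) +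
        ∑ x, if (1 + ε) * (n * p x) < letterCount z x then ∏ i, p (z i) else 0) := by
    refine Finset.sum_le_sum fun z _ => ?_
    have hnn : ∀ x ∈ Finset.univ,
        0 ≤ if (1 + ε) * (n * p x) < letterCount z x then ∏ i, p (z i) else 0 := fun x _ => by
      split_ifs
      exacts [hprod z, le_rfl]
    split_ifs with hz
    · linarith [Finset.sum_nonneg hnn]
    · obtain ⟨x, hx⟩ := not_forall.1 hz
      have := Finset.single_le_sum hnn (Finset.mem_univ x)
      rw [if_pos (not_le.1 hx)] at this
      linarith
  rw [hsum, Finset.sum_add_distrib, Finset.sum_comm (s := Finset.univ (α := Fin n → X))] at hunion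
  have := Finset.sum_le_sum fun x (_ : x ∈ Finset.univ) => hletter x
  rw [Finset.sum_const, Finset.card_univ, nsmul_eq_mul] at this
  linarith

end Typical

/-! ### Typical codes, positivity and assembly -/

section TypicalCode

variable {X Y : Type*} {W : X → PMF Y} {Q : PMF Y} {P : PMF X}

lemma pMin_le {x : X} (hx : P x ≠ 0) : pMin P ≤ (P x).toReal :=
  ENNReal.toReal_mono (P.apply_ne_top x) (iInf₂_le x ((PMF.mem_support_iff P x).2 hx))

variable [Fintype X]

lemma pMin_pos (P : PMF X) : 0 < pMin P := by
  obtain ⟨x₀, h₀⟩ := P.support_nonempty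
  obtain ⟨x₁, h₁, hmin⟩ := P.support.toFinite.exists_minimalFor P P.support ⟨x₀, h₀⟩
  have h : P x₁ ≤ ⨅ x ∈ P.support, P x := le_iInf₂ fun x hx =>
    (le_total (P x₁) (P x)).elim id fun h => hmin hx h
  have hne : P x₁ ≠ 0 := (PMF.mem_support_iff P x₁).1 h₁
  refine ENNReal.toReal_pos (ne_of_gt ((pos_iff_ne_zero.2 hne).trans_le h)) ?_
  exact ne_top_of_le_ne_top (P.apply_ne_top x₁) (iInf₂_le x₁ h₁)

variable [Fintype Y]

/-- The exponent of random codes drawn from the upper typical words. -/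
theorem typical_le_exponent (hP : P ∈ inducing W Q) {s t R ε : ℝ} (hR : 0 < R) (hst : s ≤ t)
    (ht : 0 < t) (ht1 : t ≤ 1) (h0 : 0 < ε) (h1 : ε ≤ 1) :
    ((min (ε ^ 2 * pMin P / 3) (t * (R - (1 + ε) * avgLetterDiv W Q P t)) : ℝ) : EReal) ≤
      resolvabilityExponent W Q s R := by
  classical
  set p : X → ℝ := fun x => (P x).toReal with hp
  set β := ε ^ 2 * pMin P / 3 with hβ
  have hβ0 : 0 < β := by have := pMin_pos P; positivity
  have hp0 : ∀ x, 0 ≤ p x := fun x => ENNReal.toReal_nonneg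
  have hp1 : ∑ x, p x = 1 := sum_toReal_eq_one (pmf_sum_eq_one P)
  have hne : ∀ x, p x ≠ 0 → P x ≠ 0 := fun x hx h => hx (by simp [hp, h])
  have hofReal : ∀ x, ENNReal.ofReal (p x) = P x := fun x =>
    ENNReal.ofReal_toReal (P.apply_ne_top x)
  -- Once `δ < 1/2`, `1 / κ ≤ 1 / (1 - δ) ≤ 1 + 2δ`, which is where `2 * Fintype.card X` comes from.
  refine le_exponent_of_random (K := 2 * Fintype.card X) hR hst ht ht1 (by positivity) ?_
  have hlim : Tendsto (fun n : ℕ => (Fintype.card X : ℝ) * Real.exp (-(n * β))) atTop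
      (nhds (Fintype.card X * 0)) := by
    refine Tendsto.const_mul _ (Real.tendsto_exp_neg_atTop_nhds_zero.comp ?_)
    exact tendsto_natCast_atTop_atTop.atTop_mul_const hβ0
  rw [mul_zero] at hlim
  filter_upwards [hlim.eventually (gt_mem_nhds (show (0 : ℝ) < 1 / 2 by norm_num))] with n hn
  set δ := (Fintype.card X : ℝ) * Real.exp (-(n * β)) with hδ
  have hδ0 : 0 ≤ δ := by positivity
  set κ := ∑ z : Fin n → X, if IsUpperTypical p ε z then ∏ i, p (z i) else 0 with hκ
  have hκδ : 1 - δ ≤ κ :=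
    one_sub_le_sum_upperTypical hp0 hp1 h0.le h1 fun x hx => pMin_le (hne x hx)
  have hκ0 : 0 < κ := by linarith
  have hprod : ∀ z : Fin n → X, 0 ≤ ∏ i, p (z i) := fun z => Finset.prod_nonneg fun i _ => hp0 _
  have hκ1 : κ ≤ 1 := by
    rw [← one_pow n, ← hp1, Fintype.sum_pow]
    refine Finset.sum_le_sum fun z _ => ?_
    split_ifs
    exacts [le_rfl, hprod z]
  set ν : (Fin n → X) → ℝ≥0∞ := fun z =>
    ENNReal.ofReal ((if IsUpperTypical p ε z then ∏ i, p (z i) else 0) / κ) with hνdef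
  have hν1 : ∑ z, ν z = 1 := by
    rw [hνdef, ← ENNReal.ofReal_sum_of_nonneg fun z _ => by
      split_ifs
      exacts [div_nonneg (hprod z) hκ0.le, by simp]]
    rw [← Finset.sum_div, ← hκ, div_self hκ0.ne', ENNReal.ofReal_one]
  refine ⟨ν, ENNReal.ofReal (1 / κ), hν1, fun y => ?_, ?_, ?_⟩
  · rw [← sum_iid_mul_channel hP, Finset.mul_sum]
    refine Finset.sum_le_sum fun z _ => ?_
    rw [← mul_assoc]
    gcongr
    calc ν z ≤ ENNReal.ofReal (1 / κ * ∏ i, p (z i)) := by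
          refine ENNReal.ofReal_le_ofReal ?_
          rw [one_div_mul_eq_div]
          gcongr
          split_ifs
          exacts [le_rfl, hprod z]
      _ = _ := by
          rw [ENNReal.ofReal_mul (by positivity), ENNReal.ofReal_prod_of_nonneg fun i _ => hp0 _]
          simp_rw [hofReal]
  · have hA1 : 1 ≤ ENNReal.ofReal (1 / κ) := by
      rw [ENNReal.one_le_ofReal]; exact (one_le_div hκ0).2 hκ1
    refine (ENNReal.rpow_le_rpow_of_exponent_le hA1 ht1).trans ?_
    rw [ENNReal.rpow_one]
    refine ENNReal.ofReal_le_ofReal ?_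
    rw [mul_assoc, ← hδ, div_le_iff₀ hκ0]
    nlinarith
  · have hz : ∀ z, ν z * ∏ i, ∑ y, W (z i) y ^ (1 + t) * Q y ^ (-t) ≤
        ν z * ENNReal.ofReal (Real.exp (n * (t * ((1 + ε) * avgLetterDiv W Q P t)))) := by
      intro z
      by_cases hT : IsUpperTypical p ε z
      · have hsupp : ∀ i, P (z i) ≠ 0 := fun i => hne _ fun h => by
          have h2 := hT (z i)
          rw [h, mul_zero, mul_zero] at h2
          have h3 : (0 : ℝ) < letterCount z (z i) := by exact_mod_cast letterCount_pos z i
          linarith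
        gcongr
        calc _ = ∏ i, ENNReal.ofReal (Real.exp (t * letterDiv W Q t (z i))) :=
              Finset.prod_congr rfl fun i _ => sum_rpow_mul_rpow_eq_exp (pmf_sum_eq_one _)
                Q.apply_ne_top (channel_eq_zero hP (hsupp i)) ht
          _ = ENNReal.ofReal (Real.exp (t * ∑ i, letterDiv W Q t (z i))) := by
              rw [← ENNReal.ofReal_prod_of_nonneg fun i _ => (Real.exp_pos _).le,
                ← Real.exp_sum, Finset.mul_sum]
          _ ≤ _ := by
              refine ENNReal.ofReal_le_ofReal (Real.exp_le_exp.2 ?_)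
              have := mul_le_mul_of_nonneg_left (sum_letter_le hT
                fun x hx => letterDiv_nonneg hP (hne x hx) ht.le) ht.le
              calc _ ≤ _ := this
                _ = _ := by rw [avgLetterDiv]; ring
      · simp [hνdef, hT]
    calc _ ≤ ∑ z, ν z *
          ENNReal.ofReal (Real.exp (n * (t * ((1 + ε) * avgLetterDiv W Q P t)))) :=
          Finset.sum_le_sum fun z _ => hz z
      _ = _ := by rw [← Finset.sum_mul, hν1, one_mul]

lemma min_theta_le_exponent (hP : P ∈ inducing W Q) {s s' R ε : ℝ} (hR : 0 < R) (hs : s ≤ s')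
    (hs0 : 0 ≤ s') (hs1 : s ≤ 1) (h0 : 0 < ε) (h1 : ε ≤ 1) :
    min ((ε ^ 2 * pMin P / 3 : ℝ) : EReal) (theta W Q R s' ε P) ≤
      resolvabilityExponent W Q s R := by
  rw [theta, inf_iSup₂_eq]
  refine iSup₂_le fun t ht => ?_
  rcases (hs0.trans ht.1).eq_or_lt with rfl | ht0
  · refine inf_le_right.trans ?_
    rw [EReal.coe_zero, zero_mul]
    exact zero_le_exponent hP hR hs1
  · have := typical_le_exponent hP hR (hs.trans ht.1) ht0 ht.2 h0 h1
    rw [avgDiv_eq hP]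
    rwa [EReal.coe_strictMono.monotone.map_min, EReal.coe_mul, EReal.coe_sub, EReal.coe_mul] at this

lemma expTs_le_exponent (hP : P ∈ inducing W Q) {s R : ℝ} (hR : 0 < R) (hs1 : s ≤ 1) :
    expTs W Q s R P ≤ resolvabilityExponent W Q s R := by
  unfold expTs
  split_ifs with hs
  · exact iSup₂_le fun ε hε => min_theta_le_exponent hP hR le_rfl hs.le hs1 hε.1 hε.2
  · exact iSup₂_le fun ε hε => min_theta_le_exponent hP hR (not_lt.1 hs) le_rfl hs1 hε.1 hε.2

lemma expIid_le_exponent (hP : P ∈ inducing W Q) {s R : ℝ} (hR : 0 < R) (hs1 : s ≤ 1) :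
    expIid W Q s R P ≤ resolvabilityExponent W Q s R := by
  unfold expIid
  split_ifs with hs
  · exact max_le (iSup₂_le fun t ht => iid_le_exponent hP hR ht.1 (hs.trans_le ht.1) ht.2)
      (zero_le_exponent hP hR hs1)
  · refine iSup₂_le fun t ht => ?_
    rcases ht.1.eq_or_lt with rfl | ht0
    · rw [EReal.coe_zero, zero_mul]
      exact zero_le_exponent hP hR hs1
    · exact iid_le_exponent hP hR ((not_lt.1 hs).trans ht.1) ht0 ht.2

lemma exponent_pos_of_avgLetterDiv_lt (hP : P ∈ inducing W Q) {s t R : ℝ} (hst : s ≤ t)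
    (ht : 0 < t) (ht1 : t ≤ 1) (hR : avgLetterDiv W Q P t < R) :
    0 < resolvabilityExponent W Q s R := by
  have hD := avgLetterDiv_nonneg hP ht.le
  set D := avgLetterDiv W Q P t with hDdef
  -- Chosen so that `ε * D < R - D`, which keeps `R - (1 + ε) * D` positive; `D + 1` avoids dividing
  -- by zero.
  set ε := min 1 ((R - D) / (2 * (D + 1))) with hε
  have hε0 : 0 < ε := lt_min one_pos (div_pos (sub_pos.2 hR) (by linarith))
  have hεD : ε * (2 * (D + 1)) ≤ R - D :=
    (le_div_iff₀ (by linarith)).1 (min_le_right _ _)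
  refine lt_of_lt_of_le ?_ (typical_le_exponent hP (hD.trans_lt hR) hst ht ht1 hε0
    (min_le_left _ _))
  refine EReal.coe_pos.2 (lt_min ?_ (mul_pos ht ?_))
  · have := pMin_pos P
    positivity
  · rw [← hDdef]
    nlinarith

/-- Positivity of the rate guarantees at least one message at every blocklength. -/
lemma rate_pos {s R : ℝ} (hR : rateThreshold W Q s < (R : EReal)) : 0 < R := by
  have hnn : ∀ t : ℝ, 0 ≤ t → 0 ≤ ⨅ P ∈ inducing W Q, avgDiv W Q t P := fun t ht =>
    le_iInf₂ fun P hP => by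
      rw [avgDiv_eq hP]
      exact EReal.coe_nonneg.2 (avgLetterDiv_nonneg hP ht)
  rw [← EReal.coe_pos]
  refine lt_of_le_of_lt ?_ hR
  unfold rateThreshold
  split_ifs with h1
  exacts [hnn s h1.le, hnn 0 le_rfl, le_rfl]

lemma exists_of_iInf₂_lt {ι : Type*} {S : Set ι} {f : ι → EReal} {a : EReal}
    (h : ⨅ i ∈ S, f i < a) : ∃ i ∈ S, f i < a := by
  simpa [iInf_lt_iff] using h

lemma exponent_pos {s R : ℝ} (hs : -1 < s) (hs1 : s ≤ 1)
    (hR : rateThreshold W Q s < (R : EReal)) : 0 < resolvabilityExponent W Q s R := by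
  unfold rateThreshold at hR
  split_ifs at hR with h
  · obtain ⟨P, hP, hlt⟩ := exists_of_iInf₂_lt hR
    rw [avgDiv_eq hP, EReal.coe_lt_coe_iff] at hlt
    exact exponent_pos_of_avgLetterDiv_lt hP le_rfl h hs1 hlt
  · obtain ⟨P, hP, hlt⟩ := exists_of_iInf₂_lt hR
    rw [avgDiv_eq hP, EReal.coe_lt_coe_iff] at hlt
    -- The threshold here is at `t = 0` while coding needs `t > 0`; right continuity at `0` carries
    -- the strict inequality to a small positive `t`.
    obtain ⟨t, htR, ht⟩ := (((avgLetterDiv_tendsto hP).eventually (gt_mem_nhds hlt)).and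
      (Ioc_mem_nhdsGT one_pos)).exists
    exact exponent_pos_of_avgLetterDiv_lt hP ((not_lt.1 h).trans ht.1.le) ht.1 ht.2 htR

end TypicalCode

end RenyiResolvability

end

theorem theorem6 {X Y : Type*} [Fintype X] [Fintype Y] (W : X → PMF Y) (Q : PMF Y)
    (hP : (RenyiResolvability.inducing W Q).Nonempty)
    (s : ℝ) (hs : s ∈ Set.Icc (-1 : ℝ) 1) (R : ℝ)
    (hR : RenyiResolvability.rateThreshold W Q s < (R : EReal)) :
    (⨆ P ∈ RenyiResolvability.inducing W Q,
        max (RenyiResolvability.expIid W Q s R P) (RenyiResolvability.expTs W Q s R P)) ≤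
      RenyiResolvability.resolvabilityExponent W Q s R ∧
    (-1 < s → 0 < RenyiResolvability.resolvabilityExponent W Q s R) := by
  have hR0 := RenyiResolvability.rate_pos hR
  exact ⟨iSup₂_le fun P hP => max_le (RenyiResolvability.expIid_le_exponent hP hR0 hs.2)
    (RenyiResolvability.expTs_le_exponent hP hR0 hs.2),
    fun h => RenyiResolvability.exponent_pos h hs.2 hR⟩
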